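/- **Setting.** Let $d\in\mathbb N$, $\Omega=(0,1)$ with Lebesgue measure, and $\mathbb H=L^2(\Omega;\mathbb R^d)$. Let $L,H\in C^3(\mathbb R^{2d})$ be such that, for every $q$, $L(q,\cdot)$ and $H(q,\cdot)$ are Legendre transforms of each other. Assume $L\ge 0$ and that there are $c_0,c_1,\lambda_0>0$ with $c_0|v|^2\le L(q,v)$ and $|\nabla_qL(q,v)|\le c_1$ for all $q,v\in\mathbb R^d$, and $$\lambda_0|v_1-v_0|^2\le \frac{d^2}{d\varepsilon^2}L\big((1-\varepsilon)q_0+\varepsilon q_1,(1-\varepsilon)v_0+\varepsilon v_1\big)\qquad\text{for all } q_0,q_1,v_0,v_1\in\mathbb R^d,\ \varepsilon\in[0,1].$$ Let $\Phi,\Psi\in C^3(\mathbb R^d)$ be even and bounded below, with bounded first, second and third derivatives, and let $c_\Phi,c_\Psi\in\mathbb R$ satisfy $c_\Phi I_d\le\nabla^2\Phi$, $c_\Psi I_d\le\nabla^2\Psi$. With $c^-=\max\{-c,0\}$, let $T>0$ satisfy $$T^2\big(c_\Phi^-+2\|\nabla^2\Phi\|_{L^\infty}\big)+T\big(c_\Psi^-+2\|\nabla^2\Psi\|_{L^\infty}\big)<\frac{\lambda_0}{2}.$$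 For $X,V,P\in\mathbb H$ put $$\mathcal U_*(X)=\tfrac12\int_{\Omega^2}\Psi(X(\omega)-X(\tilde\omega))\,d\omega\,d\tilde\omega,\qquad \hat L(X,V)=\int_\Omega L(X,V)\,d\omega+\tfrac12\int_{\Omega^2}\Phi(X(\omega)-X(\tilde\omega))\,d\omega\,d\tilde\omega,$$ $$\hat H(X,P)=\int_\Omega H(X,P)\,d\omega-\tfrac12\int_{\Omega^2}\Phi(X(\omega)-X(\tilde\omega))\,d\omega\,d\tilde\omega,$$ and assume that $\hat L$ is finite on $\mathbb H^2$, i.e. $L(X(\cdot),V(\cdot))$ is integrable for all $X,V\in\mathbb H$. For $t\in[0,T]$ and $X\in\mathbb H$ let $$\hat U(t,X)=\inf\Big\{\int_0^t\hat L(\gamma(s),\dot\gamma(s))\,ds+\mathcal U_*(\gamma(0))\ :\ \gamma\in AC_2(0,t;\mathbb H),\ \gamma(t)=X\Big\},$$ where $AC_2(0,t;\mathbb H)$ is the set of absolutely continuous curves $\gamma:[0,t]\to\mathbb H$ with $\int_0^t\|\dot\gamma\|_{\mathbb H}^2\,ds<\infty$. **Proposition.** Suppose that the partial derivative $\partial_t\hat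 U(t,X)$ (one-sided at $t=T$) and the gradient $\nabla_X\hat U(t,X)\in\mathbb H$ exist for all $(t,X)\in(0,T]\times\mathbb H$ and are continuous on $(0,T]\times\mathbb H$. Then, for all $(t,X)\in(0,T]\times\mathbb H$, the function $\omega\mapsto H(X(\omega),\nabla_X\hat U(t,X)(\omega))$ is integrable on $\Omega$ and $$\partial_t\hat U(t,X)+\hat H\big(X,\nabla_X\hat U(t,X)\big)=0 .$$ -/

import Mathlib

open MeasureTheory Set
open scoped RealInnerProductSpace

namespace MeanFieldHJ

noncomputable section

/-- The state space `ℝ^d` of one player. -/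
abbrev State (d : ℕ) : Type := EuclideanSpace ℝ (Fin d)

/-- Lebesgue measure on the set `Ω = (0,1)` of players. -/
abbrev playerMeasure : Measure ℝ := volume.restrict (Ioo (0 : ℝ) 1)

/-- The Hilbert space `ℍ = L²((0,1); ℝ^d)`. -/
abbrev HSpace (d : ℕ) : Type := Lp (State d) 2 playerMeasure

/-- Half the double integral over `Ω²` of `W (X ω - X ω')`. -/
def interaction {d : ℕ} (W : State d → ℝ) (X : HSpace d) : ℝ :=
  (1 / 2) * ∫ z : ℝ × ℝ, W (X z.1 - X z.2) ∂(playerMeasure.prod playerMeasure)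

/-- The collective running cost `L̂(X, V)`. -/
def LHat {d : ℕ} (L : State d → State d → ℝ) (Φ : State d → ℝ) (X V : HSpace d) : ℝ :=
  (∫ ω, L (X ω) (V ω) ∂playerMeasure) + interaction Φ X

/-- The collective Hamiltonian `Ĥ(X, P)`. -/
def HHat {d : ℕ} (H : State d → State d → ℝ) (Φ : State d → ℝ) (X P : HSpace d) : ℝ :=
  (∫ ω, H (X ω) (P ω) ∂playerMeasure) - interaction Φ X

/-- `γ ∈ AC₂(0, t; ℍ)` with velocity `V`: the curve `γ` is the primitive on `[0, t]` of
`V ∈ L²(0, t; ℍ)`, so that `V` is the derivative of `γ` almost everywhere on `[0, t]`. -/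
structure IsAC2 {d : ℕ} (t : ℝ) (γ V : ℝ → HSpace d) : Prop where
  memLp : MemLp V 2 (volume.restrict (Icc 0 t))
  eq_integral : ∀ s ∈ Icc 0 t, γ s = γ 0 + ∫ r in (0 : ℝ)..s, V r

/-- The action `∫₀ᵗ L̂(γ, γ') ds` plus the initial cost `𝒰_*(γ(0))`. -/
def totalCost {d : ℕ} (L : State d → State d → ℝ) (Φ Ψ : State d → ℝ) (t : ℝ)
    (γ V : ℝ → HSpace d) : ℝ :=
  (∫ s in (0 : ℝ)..t, LHat L Φ (γ s) (V s)) + interaction Ψ (γ 0)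

/-- The value function `Û(t, X)`: the infimum of the total cost over the `AC₂` curves on `[0, t]`
that end in `X`. The integrand of the action is bounded below, so a curve along which it is
not integrable has infinite action and does not enter the infimum. -/
def valueFn {d : ℕ} (L : State d → State d → ℝ) (Φ Ψ : State d → ℝ) (t : ℝ) (X : HSpace d) : ℝ :=
  sInf {c : ℝ | ∃ γ V : ℝ → HSpace d, IsAC2 t γ V ∧ γ t = X ∧
    IntervalIntegrable (fun s => LHat L Φ (γ s) (V s)) volume 0 t ∧
    c = totalCost L Φ Ψ t γ V}

/-- `sup_x ‖∇²W(x)‖`, with the operator norm. -/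
def hessSup {d : ℕ} (W : State d → ℝ) : ℝ := ⨆ x, ‖iteratedFDeriv ℝ 2 W x‖

/-- An interaction potential: even, of class `C³`, bounded below, with bounded derivatives of
orders one to three, and with `∇²W ≥ c I`. -/
structure IsInteraction {d : ℕ} (W : State d → ℝ) (c : ℝ) : Prop where
  contDiff : ContDiff ℝ 3 W
  even : ∀ x, W (-x) = W x
  bddBelow : BddBelow (range W)
  bounded_deriv : ∀ k ∈ Finset.Icc 1 3, ∃ C : ℝ, ∀ x, ‖iteratedFDeriv ℝ k W x‖ ≤ C
  hess_ge : ∀ x h : State d, c * ‖h‖ ^ 2 ≤ iteratedFDeriv ℝ 2 W x ![h, h]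

/-- The standing assumptions on the Lagrangian, the Hamiltonian, the interaction potentials and
the time horizon. -/
structure StandingAssumptions {d : ℕ} (L H : State d → State d → ℝ) (Φ Ψ : State d → ℝ)
    (c₀ c₁ lam₀ cΦ cΨ T : ℝ) : Prop where
  contDiff_L : ContDiff ℝ 3 (fun z : State d × State d => L z.1 z.2)
  contDiff_H : ContDiff ℝ 3 (fun z : State d × State d => H z.1 z.2)
  /-- `H(q, ·)` is the Legendre transform of `L(q, ·)`. -/
  legendre_L : ∀ q p, IsLUB (range fun v => ⟪v, p⟫ - L q v) (H q p)
  /-- `L(q, ·)` is the Legendre transform of `H(q, ·)`. -/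
  legendre_H : ∀ q v, IsLUB (range fun p => ⟪v, p⟫ - H q p) (L q v)
  L_nonneg : ∀ q v, 0 ≤ L q v
  c₀_pos : 0 < c₀
  coercive : ∀ q v, c₀ * ‖v‖ ^ 2 ≤ L q v
  c₁_pos : 0 < c₁
  grad_q_bound : ∀ q v, ‖gradient (fun q' => L q' v) q‖ ≤ c₁
  lam₀_pos : 0 < lam₀
  /-- Convexity of `L` along segments of `ℝ^{2d}`, uniform in the velocity. -/
  convex_L : ∀ q₀ q₁ v₀ v₁ : State d, ∀ ε ∈ Icc (0 : ℝ) 1,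
    lam₀ * ‖v₁ - v₀‖ ^ 2 ≤
      iteratedDeriv 2 (fun e : ℝ => L ((1 - e) • q₀ + e • q₁) ((1 - e) • v₀ + e • v₁)) ε
  /-- `L̂` is finite on `ℍ × ℍ`. -/
  integrable_L : ∀ X V : HSpace d, Integrable (fun ω => L (X ω) (V ω)) playerMeasure
  interaction_Φ : IsInteraction Φ cΦ
  interaction_Ψ : IsInteraction Ψ cΨ
  T_pos : 0 < T
  T_small : T ^ 2 * (max (-cΦ) 0 + 2 * hessSup Φ) + T * (max (-cΨ) 0 + 2 * hessSup Ψ) < lam₀ / 2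

end

end MeanFieldHJ

/-!
The value function satisfies the Hamilton–Jacobi equation wherever it is continuously
differentiable, by dynamic programming. Put `a = ∂ₜÛ(t, X)` and `P = ∇Û(t, X)`. All comparisons
look backward in time from `(t, X)`, so the final time `t = T` needs no separate treatment; the
existence of `a` and the joint continuity of the gradient give a first-order expansion of
`Û(t, X) - Û(t - h, Y)` for small `h > 0` and `Y` near `X` (`exists_backward_expansion`).

* Reaching `X` by a segment travelled at constant velocity `V` gives `a + ⟪V, P⟫ ≤ L̂(X, V)` for
  every `V ∈ ℍ` (`add_inner_le_LHat`). The maximal velocity `V(ω) = ∇ₚH(X(ω), P(ω))` lies in `ℍ` by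
  coercivity and gives equality in the Fenchel–Young inequality
  (`exists_inner_eq_LHat_add_HHat`), whence `a + Ĥ(X, P) ≤ 0`.
* For the converse, take a curve ending in `X` at time `t` that is optimal up to `h²`. Its kinetic
  energy on `[t - h, t]` is bounded through the coercivity of `L̂`; this first shows that the curve
  stays near `X`, and then, with the expansion, that its displacement `D` over `[t - h, t]` is
  `O(h)`. Integrating the Fenchel–Young inequality for the fixed covector `P` along the curve, with
  `L̂` Lipschitz in its first argument, gives `⟪D, P⟫ - h Ĥ(X, P) - o(h) ≤ h a + ⟪D, P⟫ + o(h)`,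
  whence `0 ≤ a + Ĥ(X, P)` (`neg_HHat_le`).

Near-optimal curves suffice, so no minimiser has to exist.
-/

namespace MeanFieldHJ

/-! ### Estimates in `ℍ` and for the interaction energy -/

instance : IsProbabilityMeasure playerMeasure := ⟨by simp [playerMeasure]⟩

theorem integral_norm_sub_le {d : ℕ} (X Y : HSpace d) :
    ∫ ω, ‖X ω - Y ω‖ ∂playerMeasure ≤ ‖X - Y‖ := by
  have h1 : ∫ ω, ‖X ω - Y ω‖ ∂playerMeasure =
      (eLpNorm (X - Y : HSpace d) 1 playerMeasure).toReal := by
    rw [eLpNorm_one_eq_lintegral_enorm,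
      ← integral_norm_eq_lintegral_enorm (Lp.aestronglyMeasurable _)]
    refine integral_congr_ae ?_
    filter_upwards [Lp.coeFn_sub X Y] with ω h
    rw [h]; rfl
  rw [h1, Lp.norm_def]
  exact ENNReal.toReal_mono (Lp.eLpNorm_ne_top _)
    (eLpNorm_le_eLpNorm_of_exponent_le (by norm_num) (Lp.aestronglyMeasurable _))

theorem integrable_coe {d : ℕ} (X : HSpace d) : Integrable X playerMeasure :=
  (Lp.memLp X).integrable (by norm_num)

theorem integral_norm_sq {d : ℕ} (X : HSpace d) :
    ∫ ω, ‖X ω‖ ^ 2 ∂playerMeasure = ‖X‖ ^ 2 := by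
  rw [← real_inner_self_eq_norm_sq X, L2.inner_def]
  simp

theorem integrable_norm_sq {d : ℕ} (X : HSpace d) :
    Integrable (fun ω => ‖X ω‖ ^ 2) playerMeasure := (Lp.memLp X).norm.integrable_sq

namespace IsInteraction
variable {d : ℕ} {W : State d → ℝ} {c : ℝ}

theorem exists_lipschitz (hW : IsInteraction W c) :
    ∃ K : ℝ, 0 ≤ K ∧ ∀ x y, |W x - W y| ≤ K * ‖x - y‖ := by
  obtain ⟨C, hC⟩ := hW.bounded_deriv 1 (by simp)
  refine ⟨C, (norm_nonneg _).trans (hC 0), fun x y => ?_⟩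
  have := convex_univ.norm_image_sub_le_of_norm_fderiv_le (𝕜 := ℝ) (f := W) (C := C)
    (x := y) (y := x)
    (fun z _ => (hW.contDiff.differentiable (by norm_num)) z)
    (fun z _ => by rw [← norm_iteratedFDeriv_one]; exact hC z) (mem_univ _) (mem_univ _)
  simpa using this

theorem integrable (hW : IsInteraction W c) (X : HSpace d) :
    Integrable (fun z : ℝ × ℝ => W (X z.1 - X z.2)) (playerMeasure.prod playerMeasure) := by
  obtain ⟨K, hK, hL⟩ := hW.exists_lipschitz
  have h1 : Integrable (fun z : ℝ × ℝ => X z.1 - X z.2) (playerMeasure.prod playerMeasure) :=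
    ((integrable_coe X).comp_fst _).sub ((integrable_coe X).comp_snd _)
  refine Integrable.mono' ((integrable_const |W 0|).add (h1.norm.const_mul K))
    (hW.contDiff.continuous.comp_aestronglyMeasurable h1.aestronglyMeasurable) ?_
  refine Filter.Eventually.of_forall fun z => ?_
  have h2 := hL (X z.1 - X z.2) 0
  have h3 := abs_sub_abs_le_abs_sub (W (X z.1 - X z.2)) (W 0)
  rw [sub_zero] at h2
  simp only [Real.norm_eq_abs, Pi.add_apply]
  linarith

theorem exists_interaction_lipschitz (hW : IsInteraction W c) :
    ∃ K : ℝ, 0 ≤ K ∧ ∀ X Y : HSpace d, |interaction W X - interaction W Y| ≤ K * ‖X - Y‖ := by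
  obtain ⟨K, hK, hL⟩ := hW.exists_lipschitz
  refine ⟨K, hK, fun X Y => ?_⟩
  have hi : Integrable (fun ω => ‖X ω - Y ω‖) playerMeasure :=
    ((integrable_coe X).sub (integrable_coe Y)).norm
  have h1 : |∫ z : ℝ × ℝ, (W (X z.1 - X z.2) - W (Y z.1 - Y z.2))
      ∂(playerMeasure.prod playerMeasure)| ≤ ∫ z : ℝ × ℝ,
        K * (‖X z.1 - Y z.1‖ + ‖X z.2 - Y z.2‖) ∂(playerMeasure.prod playerMeasure) := by
    rw [← Real.norm_eq_abs]
    refine norm_integral_le_of_norm_le (((hi.comp_fst _).add (hi.comp_snd _)).const_mul K)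
      (Filter.Eventually.of_forall fun z => (hL _ _).trans ?_)
    gcongr
    rw [show X z.1 - X z.2 - (Y z.1 - Y z.2) = (X z.1 - Y z.1) - (X z.2 - Y z.2) by abel]
    exact norm_sub_le _ _
  rw [integral_const_mul, integral_add (hi.comp_fst _) (hi.comp_snd _),
    integral_sub (hW.integrable X) (hW.integrable Y),
    integral_fun_fst (fun ω => ‖X ω - Y ω‖), integral_fun_snd (fun ω => ‖X ω - Y ω‖)] at h1
  simp only [probReal_univ, one_smul] at h1
  rw [interaction, interaction, ← mul_sub, abs_mul, abs_of_pos (by norm_num : (0:ℝ) < 1 / 2)]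
  nlinarith [integral_norm_sub_le X Y]

theorem exists_interaction_ge (hW : IsInteraction W c) :
    ∃ m : ℝ, ∀ X : HSpace d, m ≤ interaction W X := by
  obtain ⟨m, hm⟩ := hW.bddBelow
  refine ⟨1 / 2 * m, fun X => ?_⟩
  have := integral_mono (integrable_const m) (hW.integrable X) (fun z => hm ⟨_, rfl⟩)
  simp only [integral_const, probReal_univ, one_smul] at this
  rw [interaction]
  linarith

end IsInteraction

/-! ### The collective Lagrangian and Hamiltonian -/

namespace StandingAssumptions
variable {d : ℕ} {L H : State d → State d → ℝ} {Φ Ψ : State d → ℝ}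
  {c₀ c₁ lam₀ cΦ cΨ T : ℝ}

theorem lagrangian_lipschitz (hA : StandingAssumptions L H Φ Ψ c₀ c₁ lam₀ cΦ cΨ T)
    (q q' v : State d) : |L q v - L q' v| ≤ c₁ * ‖q - q'‖ := by
  have hd : Differentiable ℝ (fun q => L q v) :=
    (hA.contDiff_L.differentiable (by norm_num)).comp
      (differentiable_id.prodMk (differentiable_const v))
  have := convex_univ.norm_image_sub_le_of_norm_fderiv_le (𝕜 := ℝ) (f := fun q => L q v)
    (C := c₁) (x := q') (y := q) (fun z _ => hd z)
    (fun z _ => by simpa [gradient] using hA.grad_q_bound z v) (mem_univ _) (mem_univ _)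
  simpa using this

theorem exists_LHat_lipschitz (hA : StandingAssumptions L H Φ Ψ c₀ c₁ lam₀ cΦ cΨ T) :
    ∃ K : ℝ, 0 ≤ K ∧ ∀ X Y V : HSpace d, |LHat L Φ X V - LHat L Φ Y V| ≤ K * ‖X - Y‖ := by
  obtain ⟨K, hK, hL⟩ := hA.interaction_Φ.exists_interaction_lipschitz
  refine ⟨c₁ + K, add_nonneg hA.c₁_pos.le hK, fun X Y V => ?_⟩
  have h1 : |∫ ω, (L (X ω) (V ω) - L (Y ω) (V ω)) ∂playerMeasure| ≤ c₁ * ‖X - Y‖ := by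
    refine le_trans ?_ (mul_le_mul_of_nonneg_left (integral_norm_sub_le X Y) hA.c₁_pos.le)
    rw [← Real.norm_eq_abs, ← integral_const_mul]
    exact norm_integral_le_of_norm_le
      (((integrable_coe X).sub (integrable_coe Y)).norm.const_mul c₁)
      (Filter.Eventually.of_forall fun ω => hA.lagrangian_lipschitz _ _ _)
  rw [integral_sub (hA.integrable_L X V) (hA.integrable_L Y V)] at h1
  have h2 := hL X Y
  rw [LHat, LHat, add_sub_add_comm, add_mul]
  exact (abs_add_le _ _).trans (add_le_add h1 h2)

theorem exists_LHat_coercive (hA : StandingAssumptions L H Φ Ψ c₀ c₁ lam₀ cΦ cΨ T) :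
    ∃ m : ℝ, ∀ X V : HSpace d, c₀ * ‖V‖ ^ 2 + m ≤ LHat L Φ X V := by
  obtain ⟨m, hm⟩ := hA.interaction_Φ.exists_interaction_ge
  refine ⟨m, fun X V => add_le_add ?_ (hm X)⟩
  rw [← integral_norm_sq V, ← integral_const_mul]
  exact integral_mono ((integrable_norm_sq V).const_mul c₀) (hA.integrable_L X V)
    fun ω => hA.coercive _ _

theorem le_hamiltonian (hA : StandingAssumptions L H Φ Ψ c₀ c₁ lam₀ cΦ cΨ T)
    (q p v : State d) : ⟪v, p⟫ - L q v ≤ H q p := (hA.legendre_L q p).1 ⟨v, rfl⟩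

/-- `H(X, P)` lies between the integrable functions `-L(X, 0)` and `‖P‖² / (4c₀)`, by duality and
coercivity. -/
theorem integrable_hamiltonian (hA : StandingAssumptions L H Φ Ψ c₀ c₁ lam₀ cΦ cΨ T)
    (X P : HSpace d) : Integrable (fun ω => H (X ω) (P ω)) playerMeasure := by
  have h0 : Integrable (fun ω => L (X ω) 0) playerMeasure :=
    (hA.integrable_L X 0).congr (by
      filter_upwards [Lp.coeFn_zero (State d) 2 playerMeasure] with ω h
      rw [h]; rfl)
  refine Integrable.mono' (h0.add ((integrable_norm_sq P).const_mul (1 / (4 * c₀))))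
    (hA.contDiff_H.continuous.comp_aestronglyMeasurable
      ((Lp.aestronglyMeasurable X).prodMk (Lp.aestronglyMeasurable P)))
    (Filter.Eventually.of_forall fun ω => ?_)
  have hc := hA.c₀_pos
  have h1 := hA.le_hamiltonian (X ω) (P ω) 0
  have h2 : H (X ω) (P ω) ≤ 1 / (4 * c₀) * ‖P ω‖ ^ 2 := by
    refine (hA.legendre_L _ _).2 ?_
    rintro _ ⟨v, rfl⟩
    have h3 := hA.coercive (X ω) v
    have h4 := real_inner_le_norm v (P ω)
    have h5 : 1 / (4 * c₀) * ‖P ω‖ ^ 2 - ‖v‖ * ‖P ω‖ + c₀ * ‖v‖ ^ 2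
        = c₀ * (‖v‖ - ‖P ω‖ / (2 * c₀)) ^ 2 := by field_simp; ring
    have h6 : 0 ≤ c₀ * (‖v‖ - ‖P ω‖ / (2 * c₀)) ^ 2 := by positivity
    simp only
    linarith
  have h3 := hA.L_nonneg (X ω) 0
  have h4 : 0 ≤ 1 / (4 * c₀) * ‖P ω‖ ^ 2 := by positivity
  rw [inner_zero_left] at h1
  simp only [Real.norm_eq_abs, Pi.add_apply]
  exact abs_le.2 ⟨by linarith, by linarith⟩

/-- Fenchel–Young inequality for the collective Lagrangian and Hamiltonian. -/
theorem inner_le_LHat_add_HHat (hA : StandingAssumptions L H Φ Ψ c₀ c₁ lam₀ cΦ cΨ T)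
    (X P V : HSpace d) : ⟪V, P⟫ ≤ LHat L Φ X V + HHat H Φ X P := by
  rw [L2.inner_def, LHat, HHat, add_add_sub_cancel,
    ← integral_add (hA.integrable_L X V) (hA.integrable_hamiltonian X P)]
  refine integral_mono (L2.integrable_inner V P)
    ((hA.integrable_L X V).add (hA.integrable_hamiltonian X P)) fun ω => ?_
  have := hA.le_hamiltonian (X ω) (P ω) (V ω)
  simp only
  linarith

theorem exists_maximizer (hA : StandingAssumptions L H Φ Ψ c₀ c₁ lam₀ cΦ cΨ T)
    (q p : State d) : ∃ v, H q p = ⟪v, p⟫ - L q v := by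
  have hLc : Continuous (fun v => L q v) :=
    hA.contDiff_L.continuous.comp (continuous_const.prodMk continuous_id)
  have hcont : Continuous (fun v => L q v - ⟪v, p⟫) := hLc.sub (by fun_prop)
  have hc := hA.c₀_pos
  have hlim : Filter.Tendsto (fun v : State d => L q v - ⟪v, p⟫) (Filter.cocompact _)
      Filter.atTop := by
    have h1 : Filter.Tendsto (fun x : ℝ => x * (c₀ * x - ‖p‖)) Filter.atTop Filter.atTop :=
      Filter.tendsto_id.atTop_mul_atTop₀
        (Filter.tendsto_atTop_add_const_right _ _ (Filter.tendsto_id.const_mul_atTop hc))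
    refine Filter.tendsto_atTop_mono (fun v => ?_)
      (h1.comp (tendsto_norm_cocompact_atTop (E := State d)))
    have h2 := hA.coercive q v
    have h3 := real_inner_le_norm v p
    simp only [Function.comp]
    nlinarith
  obtain ⟨v, hv⟩ := hcont.exists_forall_le hlim
  refine ⟨v, le_antisymm ((hA.legendre_L q p).2 ?_) (hA.le_hamiltonian q p v)⟩
  rintro _ ⟨w, rfl⟩
  have := hv w
  simp only
  linarith

/-- The velocity maximising `⟪v, p⟫ - L(q, v)` is `∇ₚH(q, p)`, hence depends continuously on
`(q, p)`. -/
theorem hamiltonian_eq_gradient (hA : StandingAssumptions L H Φ Ψ c₀ c₁ lam₀ cΦ cΨ T)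
    (q p : State d) : H q p = ⟪gradient (H q) p, p⟫ - L q (gradient (H q) p) := by
  obtain ⟨v, hv⟩ := hA.exists_maximizer q p
  have hd : DifferentiableAt ℝ (H q) p :=
    ((hA.contDiff_H.differentiable (by norm_num)).comp
      ((differentiable_const q).prodMk differentiable_id)) p
  -- `H(q, ·)` lies above the affine function `⟪v, ·⟫ - L(q, v)` and touches it at `p`.
  have hmin : IsLocalMin (fun x => H q x - ⟪v, x⟫) p := by
    refine Filter.Eventually.of_forall fun x => ?_
    have := hA.le_hamiltonian q x v
    simp only
    linarith
  have h1 := hmin.hasFDerivAt_eq_zero (hd.hasFDerivAt.sub ((innerSL ℝ v).hasFDerivAt))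
  have h2 : gradient (H q) p = v := by
    rw [gradient, LinearIsometryEquiv.symm_apply_eq, sub_eq_zero.1 h1]
    rfl
  rw [h2]; exact hv

theorem continuous_gradient_hamiltonian
    (hA : StandingAssumptions L H Φ Ψ c₀ c₁ lam₀ cΦ cΨ T) :
    Continuous (fun z : State d × State d => gradient (H z.1) z.2) := by
  refine (InnerProductSpace.toDual ℝ (State d)).symm.continuous.comp ?_
  have h : ∀ z : State d × State d, fderiv ℝ (H z.1) z.2 =
      (fderiv ℝ (fun z : State d × State d => H z.1 z.2) z).comp
        (ContinuousLinearMap.inr ℝ _ _) := fun z =>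
    (((hA.contDiff_H.differentiable (by norm_num)) (z.1, z.2)).hasFDerivAt.comp z.2
      (hasFDerivAt_prodMk_right z.1 z.2)).fderiv
  simp only [h]
  exact (hA.contDiff_H.continuous_fderiv (by norm_num)).clm_comp continuous_const

/-- Equality is attained in the Fenchel–Young inequality: `Ĥ` is the Legendre transform of `L̂`. -/
theorem exists_inner_eq_LHat_add_HHat (hA : StandingAssumptions L H Φ Ψ c₀ c₁ lam₀ cΦ cΨ T)
    (X P : HSpace d) : ∃ V : HSpace d, ⟪V, P⟫ = LHat L Φ X V + HHat H Φ X P := by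
  have hc := hA.c₀_pos
  set v : ℝ → State d := fun ω => gradient (H (X ω)) (P ω) with hv
  have hm : AEStronglyMeasurable v playerMeasure :=
    hA.continuous_gradient_hamiltonian.comp_aestronglyMeasurable
      ((Lp.aestronglyMeasurable X).prodMk (Lp.aestronglyMeasurable P))
  have heq : ∀ ω, H (X ω) (P ω) = ⟪v ω, P ω⟫ - L (X ω) (v ω) := fun ω =>
    hA.hamiltonian_eq_gradient _ _
  -- Half of the coercive term `c₀‖v‖²` absorbs `⟪v, P⟫`, so that `v` is square integrable.
  have hbound : ∀ ω, ‖v ω‖ ^ 2 ≤ (2 / c₀) * ((1 / (2 * c₀)) * ‖P ω‖ ^ 2 - H (X ω) (P ω)) := by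
    intro ω
    have h1 := hA.coercive (X ω) (v ω)
    have h2 := real_inner_le_norm (v ω) (P ω)
    have h3 := heq ω
    have h4 : ‖v ω‖ * ‖P ω‖ ≤ c₀ / 2 * ‖v ω‖ ^ 2 + 1 / (2 * c₀) * ‖P ω‖ ^ 2 := by
      have h5 : c₀ / 2 * ‖v ω‖ ^ 2 + 1 / (2 * c₀) * ‖P ω‖ ^ 2 - ‖v ω‖ * ‖P ω‖
        = c₀ / 2 * (‖v ω‖ - ‖P ω‖ / c₀) ^ 2 := by field_simp; ring
      have h6 : 0 ≤ c₀ / 2 * (‖v ω‖ - ‖P ω‖ / c₀) ^ 2 := by positivity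
      linarith
    rw [div_mul_eq_mul_div, le_div_iff₀ hc]
    linarith
  have hmem : MemLp v 2 playerMeasure := by
    rw [← memLp_norm_iff hm, memLp_two_iff_integrable_sq hm.norm]
    refine Integrable.mono' ((((integrable_norm_sq P).const_mul (1 / (2 * c₀))).sub
      (hA.integrable_hamiltonian X P)).const_mul (2 / c₀)) (hm.norm.pow 2)
      (Filter.Eventually.of_forall fun ω => ?_)
    rw [Real.norm_eq_abs, abs_of_nonneg (by positivity)]
    exact hbound ω
  refine ⟨hmem.toLp v, ?_⟩
  rw [L2.inner_def, LHat, HHat, add_add_sub_cancel,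
    ← integral_add (hA.integrable_L X _) (hA.integrable_hamiltonian X P)]
  refine integral_congr_ae ?_
  filter_upwards [hmem.coeFn_toLp] with ω h
  rw [h, heq ω]
  ring

end StandingAssumptions

/-! ### Curves of finite kinetic energy -/

namespace IsAC2
variable {d : ℕ} {s t : ℝ} {γ V : ℝ → HSpace d}

theorem mono (h : IsAC2 t γ V) (hst : s ≤ t) : IsAC2 s γ V where
  memLp := h.memLp.mono_measure (Measure.restrict_mono (Icc_subset_Icc_right hst) le_rfl)
  eq_integral r hr := h.eq_integral r (Icc_subset_Icc_right hst hr)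

theorem integrableOn (h : IsAC2 t γ V) : IntegrableOn V (Icc 0 t) :=
  h.memLp.integrable (by norm_num)

theorem intervalIntegrable (h : IsAC2 t γ V) {a b : ℝ} (ha : a ∈ Icc 0 t) (hb : b ∈ Icc 0 t) :
    IntervalIntegrable V volume a b := by
  rw [intervalIntegrable_iff]
  exact h.integrableOn.mono_set (uIoc_subset_uIcc.trans (uIcc_subset_Icc ha hb))

theorem intervalIntegrable_norm_sq (h : IsAC2 t γ V) {a b : ℝ} (ha : a ∈ Icc 0 t)
    (hb : b ∈ Icc 0 t) : IntervalIntegrable (fun r => ‖V r‖ ^ 2) volume a b := by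
  rw [intervalIntegrable_iff]
  have : IntegrableOn (fun r => ‖V r‖ ^ 2) (Icc 0 t) := h.memLp.norm.integrable_sq
  exact this.mono_set (uIoc_subset_uIcc.trans (uIcc_subset_Icc ha hb))

theorem sub_eq_integral (h : IsAC2 t γ V) {a b : ℝ} (ha : a ∈ Icc 0 t) (hb : b ∈ Icc 0 t) :
    γ b - γ a = ∫ r in a..b, V r := by
  have h0 : (0 : ℝ) ∈ Icc 0 t := ⟨le_rfl, ha.1.trans ha.2⟩
  rw [h.eq_integral a ha, h.eq_integral b hb, add_sub_add_left_eq_sub,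
    intervalIntegral.integral_interval_sub_left (h.intervalIntegrable h0 hb)
      (h.intervalIntegrable h0 ha)]

/-- Displacement is controlled by kinetic energy, by the Cauchy–Schwarz inequality in time. -/
theorem norm_sub_sq_le (h : IsAC2 t γ V) {a b : ℝ} (ha : a ∈ Icc 0 t) (hb : b ∈ Icc 0 t)
    (hab : a ≤ b) : ‖γ b - γ a‖ ^ 2 ≤ (b - a) * ∫ r in a..b, ‖V r‖ ^ 2 := by
  rcases hab.eq_or_lt with rfl | hlt
  · simp
  have hpos : 0 < b - a := sub_pos.2 hlt
  have hV := (h.intervalIntegrable ha hb).norm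
  have hV2 := h.intervalIntegrable_norm_sq ha hb
  have h1 : ‖γ b - γ a‖ ≤ ∫ r in a..b, ‖V r‖ := by
    rw [h.sub_eq_integral ha hb]
    exact intervalIntegral.norm_integral_le_integral_norm hab
  set I := ∫ r in a..b, ‖V r‖ with hI
  -- The variance of `‖V‖` on `[a, b]` is nonnegative.
  have h2 : 0 ≤ ∫ r in a..b, (‖V r‖ - I / (b - a)) ^ 2 :=
    intervalIntegral.integral_nonneg hab fun r _ => sq_nonneg _
  have h3 : ∫ r in a..b, (‖V r‖ - I / (b - a)) ^ 2 =
      (∫ r in a..b, ‖V r‖ ^ 2) - I ^ 2 / (b - a) := by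
    have h4 : ∀ r, (‖V r‖ - I / (b - a)) ^ 2 =
        ‖V r‖ ^ 2 - 2 * (I / (b - a)) * ‖V r‖ + (I / (b - a)) ^ 2 := fun r => by ring
    simp only [h4]
    rw [intervalIntegral.integral_add (hV2.sub (hV.const_mul _)) intervalIntegrable_const,
      intervalIntegral.integral_sub hV2 (hV.const_mul _), intervalIntegral.integral_const_mul,
      intervalIntegral.integral_const, ← hI, smul_eq_mul]
    field_simp
    ring
  have h5 : I ^ 2 / (b - a) ≤ ∫ r in a..b, ‖V r‖ ^ 2 := by linarith
  rw [div_le_iff₀ hpos] at h5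
  have h6 : ‖γ b - γ a‖ ^ 2 ≤ I ^ 2 := by gcongr
  linarith

/-- Appending to a curve on `[0, s]` a segment travelled at constant velocity `w`. -/
theorem append_segment (h : IsAC2 s γ V) (hs : 0 ≤ s) (w : HSpace d) :
    IsAC2 t (fun r => if r ≤ s then γ r else γ s + (r - s) • w)
      (fun r => if r ≤ s then V r else w) := by
  have h0 : (0 : ℝ) ∈ Icc 0 s := ⟨le_rfl, hs⟩
  have hss : s ∈ Icc 0 s := ⟨hs, le_rfl⟩
  have hpre : ∀ r ∈ Icc 0 s, ∫ x in (0 : ℝ)..r, (if x ≤ s then V x else w) =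
      ∫ x in (0 : ℝ)..r, V x := by
    intro r hr
    refine intervalIntegral.integral_congr_ae (Filter.Eventually.of_forall fun x hx => ?_)
    rw [uIoc_of_le hr.1] at hx
    exact if_pos (hx.2.trans hr.2)
  refine ⟨?_, fun r hr => ?_⟩
  · refine MemLp.piecewise (s := Iic s) (f := V) (g := fun _ => w) measurableSet_Iic ?_ ?_
    · rw [Measure.restrict_restrict measurableSet_Iic]
      have hsub : Iic s ∩ Icc 0 t ⊆ Icc 0 s := fun x hx => ⟨hx.2.1, hx.1⟩
      exact h.memLp.mono_measure (Measure.restrict_mono hsub le_rfl)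
    · exact memLp_const w
  · simp only [if_pos hs]
    by_cases hrs : r ≤ s
    · rw [if_pos hrs, hpre r ⟨hr.1, hrs⟩]
      exact h.eq_integral r ⟨hr.1, hrs⟩
    · have hsr : s ≤ r := (not_le.1 hrs).le
      have htail : ∀ x ∈ uIoc s r, (if x ≤ s then V x else w) = w := fun x hx => by
        rw [uIoc_of_le hsr] at hx
        exact if_neg (not_le.2 hx.1)
      have hi1 : IntervalIntegrable (fun x => if x ≤ s then V x else w) volume 0 s :=
        (h.intervalIntegrable h0 hss).congr fun x hx => by
          rw [uIoc_of_le hs] at hx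
          exact (if_pos hx.2).symm
      have hi2 : IntervalIntegrable (fun x => if x ≤ s then V x else w) volume s r :=
        (intervalIntegrable_const (c := w)).congr fun x hx => (htail x hx).symm
      rw [if_neg hrs, ← intervalIntegral.integral_add_adjacent_intervals hi1 hi2, hpre s hss,
        intervalIntegral.integral_congr_ae (Filter.Eventually.of_forall htail),
        intervalIntegral.integral_const, ← add_assoc, ← h.eq_integral s hss]

end IsAC2

/-! ### Dynamic programming -/

namespace StandingAssumptions
variable {d : ℕ} {L H : State d → State d → ℝ} {Φ Ψ : State d → ℝ}
  {c₀ c₁ lam₀ cΦ cΨ T : ℝ}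

/-- The total cost is bounded below, so the infimum defining the value function is a genuine one. -/
theorem exists_totalCost_ge (hA : StandingAssumptions L H Φ Ψ c₀ c₁ lam₀ cΦ cΨ T) :
    ∃ m m' : ℝ, ∀ (t : ℝ) (γ V : ℝ → HSpace d), 0 ≤ t →
      IntervalIntegrable (fun s => LHat L Φ (γ s) (V s)) volume 0 t →
      t * m + m' ≤ totalCost L Φ Ψ t γ V := by
  obtain ⟨m, hm⟩ := hA.exists_LHat_coercive
  obtain ⟨m', hm'⟩ := hA.interaction_Ψ.exists_interaction_ge
  refine ⟨m, m', fun t γ V ht hi => add_le_add ?_ (hm' _)⟩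
  have := intervalIntegral.integral_mono ht (intervalIntegrable_const (c := m)) hi fun s =>
    (le_add_of_nonneg_left (mul_nonneg hA.c₀_pos.le (sq_nonneg _))).trans (hm (γ s) (V s))
  simpa using this

theorem valueFn_le_totalCost (hA : StandingAssumptions L H Φ Ψ c₀ c₁ lam₀ cΦ cΨ T)
    {t : ℝ} (ht : 0 ≤ t) {X : HSpace d} {γ V : ℝ → HSpace d} (hγ : IsAC2 t γ V) (hX : γ t = X)
    (hi : IntervalIntegrable (fun s => LHat L Φ (γ s) (V s)) volume 0 t) :
    valueFn L Φ Ψ t X ≤ totalCost L Φ Ψ t γ V := by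
  obtain ⟨m, m', hm⟩ := hA.exists_totalCost_ge
  refine csInf_le ⟨t * m + m', ?_⟩ ⟨γ, V, hγ, hX, hi, rfl⟩
  rintro _ ⟨γ', V', -, -, hi', rfl⟩
  exact hm t γ' V' ht hi'

/-- The curve that rests at `X` is a competitor, so the infimum defining the value function is not
the junk value `sInf ∅ = 0`. -/
theorem competitors_nonempty (t : ℝ) (X : HSpace d) :
    {c : ℝ | ∃ γ V : ℝ → HSpace d, IsAC2 t γ V ∧ γ t = X ∧
      IntervalIntegrable (fun s => LHat L Φ (γ s) (V s)) volume 0 t ∧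
      c = totalCost L Φ Ψ t γ V}.Nonempty :=
  ⟨_, fun _ => X, fun _ => 0, ⟨memLp_const 0, by simp⟩, rfl, intervalIntegrable_const, rfl⟩

theorem exists_totalCost_lt (L : State d → State d → ℝ) (Φ Ψ : State d → ℝ) (t : ℝ)
    (X : HSpace d) {ε : ℝ} (hε : 0 < ε) :
    ∃ γ V : ℝ → HSpace d, IsAC2 t γ V ∧ γ t = X ∧
      IntervalIntegrable (fun s => LHat L Φ (γ s) (V s)) volume 0 t ∧
      totalCost L Φ Ψ t γ V < valueFn L Φ Ψ t X + ε := by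
  obtain ⟨_, ⟨γ, V, h1, h2, h3, rfl⟩, h⟩ :=
    exists_lt_of_csInf_lt (competitors_nonempty (L := L) (Φ := Φ) (Ψ := Ψ) t X)
      (lt_add_of_pos_right (valueFn L Φ Ψ t X) hε)
  exact ⟨γ, V, h1, h2, h3, h⟩

theorem exists_valueFn_ge (hA : StandingAssumptions L H Φ Ψ c₀ c₁ lam₀ cΦ cΨ T) :
    ∃ m m' : ℝ, ∀ t : ℝ, 0 ≤ t → ∀ X : HSpace d, t * m + m' ≤ valueFn L Φ Ψ t X := by
  obtain ⟨m, m', hm⟩ := hA.exists_totalCost_ge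
  refine ⟨m, m', fun t ht X => le_csInf (competitors_nonempty t X) ?_⟩
  rintro _ ⟨γ', V', -, -, hi', rfl⟩
  exact hm t γ' V' ht hi'

theorem continuous_LHat_left (hA : StandingAssumptions L H Φ Ψ c₀ c₁ lam₀ cΦ cΨ T)
    (V : HSpace d) : Continuous fun X => LHat L Φ X V := by
  obtain ⟨K, hK, hL⟩ := hA.exists_LHat_lipschitz
  exact (LipschitzWith.of_dist_le_mul (K := ⟨K, hK⟩) fun X Y => by
    rw [Real.dist_eq, dist_eq_norm]; exact hL X Y V).continuous

/-- Half of the dynamic programming principle: reaching `X` at time `t` by a segment at constant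
velocity `w` from an optimal state at time `s`. -/
theorem valueFn_le_of_segment (hA : StandingAssumptions L H Φ Ψ c₀ c₁ lam₀ cΦ cΨ T)
    {s t : ℝ} (hs : 0 ≤ s) (hst : s < t) (Y w : HSpace d) :
    valueFn L Φ Ψ t (Y + (t - s) • w) ≤
      valueFn L Φ Ψ s Y + ∫ r in s..t, LHat L Φ (Y + (r - s) • w) w := by
  refine le_of_forall_pos_le_add fun ε hε => ?_
  obtain ⟨γ, V, hγ, rfl, hi, hlt⟩ := exists_totalCost_lt L Φ Ψ s Y hε
  set γ' : ℝ → HSpace d := fun r => if r ≤ s then γ r else γ s + (r - s) • w with hγ'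
  set V' : ℝ → HSpace d := fun r => if r ≤ s then V r else w with hV'
  have hpre : ∀ r ∈ uIoc 0 s, LHat L Φ (γ' r) (V' r) = LHat L Φ (γ r) (V r) := fun r hr => by
    rw [uIoc_of_le hs] at hr
    simp only [hγ', hV', if_pos hr.2]
  have htail : ∀ r ∈ uIoc s t, LHat L Φ (γ' r) (V' r) =
      LHat L Φ (γ s + (r - s) • w) w := fun r hr => by
    rw [uIoc_of_le hst.le] at hr
    simp only [hγ', hV', if_neg (not_le.2 hr.1)]
  have hi1 : IntervalIntegrable (fun r => LHat L Φ (γ' r) (V' r)) volume 0 s :=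
    hi.congr fun r hr => (hpre r hr).symm
  have hc : Continuous fun r : ℝ => LHat L Φ (γ s + (r - s) • w) w :=
    (hA.continuous_LHat_left w).comp (by fun_prop)
  have hi2 : IntervalIntegrable (fun r => LHat L Φ (γ' r) (V' r)) volume s t :=
    (hc.intervalIntegrable s t).congr fun r hr => (htail r hr).symm
  have h1 : valueFn L Φ Ψ t (γ s + (t - s) • w) ≤ totalCost L Φ Ψ t γ' V' :=
    hA.valueFn_le_totalCost (hs.trans hst.le) (hγ.append_segment (t := t) hs w)
      (if_neg (not_le.2 hst)) (hi1.trans hi2)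
  rw [totalCost, ← intervalIntegral.integral_add_adjacent_intervals hi1 hi2,
    intervalIntegral.integral_congr_ae (Filter.Eventually.of_forall hpre),
    intervalIntegral.integral_congr_ae (Filter.Eventually.of_forall htail),
    show γ' 0 = γ 0 from if_pos hs] at h1
  rw [totalCost] at hlt
  linarith

/-- The other half of the dynamic programming principle: near-optimal curves exist, and they are
near-optimal on initial intervals. -/
theorem exists_valueFn_add_integral_le (hA : StandingAssumptions L H Φ Ψ c₀ c₁ lam₀ cΦ cΨ T)
    (t : ℝ) (X : HSpace d) {ε : ℝ} (hε : 0 < ε) :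
    ∃ γ V : ℝ → HSpace d, IsAC2 t γ V ∧ γ t = X ∧
      IntervalIntegrable (fun s => LHat L Φ (γ s) (V s)) volume 0 t ∧
      ∀ s ∈ Icc 0 t, valueFn L Φ Ψ s (γ s) + ∫ r in s..t, LHat L Φ (γ r) (V r) ≤
        valueFn L Φ Ψ t X + ε := by
  obtain ⟨γ, V, hγ, hX, hi, hlt⟩ := exists_totalCost_lt L Φ Ψ t X hε
  refine ⟨γ, V, hγ, hX, hi, fun s hs => ?_⟩
  have ht : (0 : ℝ) ≤ t := hs.1.trans hs.2
  have hi1 : IntervalIntegrable (fun r => LHat L Φ (γ r) (V r)) volume 0 s :=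
    hi.mono_set (by rw [uIcc_of_le hs.1, uIcc_of_le ht]; exact Icc_subset_Icc_right hs.2)
  have hi2 : IntervalIntegrable (fun r => LHat L Φ (γ r) (V r)) volume s t :=
    hi.mono_set (by rw [uIcc_of_le hs.2, uIcc_of_le ht]; exact Icc_subset_Icc_left hs.1)
  have h1 := hA.valueFn_le_totalCost hs.1 (hγ.mono hs.2) rfl hi1
  rw [totalCost] at h1 hlt
  rw [← intervalIntegral.integral_add_adjacent_intervals hi1 hi2] at hlt
  linarith

end StandingAssumptions

/-! ### First-order expansion -/

/-- First-order expansion, backward in time, of a function whose time derivative exists at one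
point and whose spatial gradient exists and is jointly continuous. -/
theorem exists_backward_expansion {E : Type*} [NormedAddCommGroup E] [InnerProductSpace ℝ E]
    [CompleteSpace E] {U : ℝ → E → ℝ} {T t : ℝ} (ht : t ∈ Ioc 0 T) (X : E)
    (hd : DifferentiableWithinAt ℝ (fun s => U s X) (Icc 0 T) t)
    (hX : ∀ s ∈ Ioc 0 T, Differentiable ℝ (U s))
    (hXc : ContinuousOn (fun z : ℝ × E => gradient (U z.1) z.2) (Ioc 0 T ×ˢ univ))
    {ε : ℝ} (hε : 0 < ε) :
    ∃ δ : ℝ, 0 < δ ∧ δ ≤ t ∧ ∀ h ∈ Ioo 0 δ, ∀ Y : E, ‖X - Y‖ < δ →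
      |U t X - U (t - h) Y - (h * derivWithin (fun s => U s X) (Icc 0 T) t +
        ⟪X - Y, gradient (U t) X⟫)| ≤ ε * (h + ‖X - Y‖) := by
  have h1 := hd.hasDerivWithinAt.hasFDerivWithinAt.isLittleO.def hε
  rw [Filter.Eventually, Metric.mem_nhdsWithin_iff] at h1
  obtain ⟨δ₁, hδ₁, h1⟩ := h1
  have h2 := hXc (t, X) ⟨ht, mem_univ _⟩
  rw [Metric.continuousWithinAt_iff] at h2
  obtain ⟨δ₂, hδ₂, h2⟩ := h2 ε hε
  refine ⟨min t (min δ₁ δ₂), lt_min ht.1 (lt_min hδ₁ hδ₂), min_le_left _ _, fun h hh Y hY => ?_⟩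
  obtain ⟨hh0, hh⟩ := hh
  rw [lt_min_iff, lt_min_iff] at hh hY
  have hts : t - h ∈ Ioc 0 T := ⟨by linarith, by linarith [ht.2]⟩
  have h3 : |U (t - h) X - U t X + h * derivWithin (fun s => U s X) (Icc 0 T) t| ≤ ε * h := by
    have := h1 (a := t - h) ⟨by simpa [Real.dist_eq, abs_of_pos hh0] using hh.2.1,
      hts.1.le, hts.2⟩
    simpa [abs_of_pos hh0] using this
  have h4 : |U (t - h) X - U (t - h) Y - ⟪X - Y, gradient (U t) X⟫| ≤ ε * ‖X - Y‖ := by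
    have := (convex_ball X δ₂).norm_image_sub_le_of_norm_fderiv_le' (𝕜 := ℝ) (f := U (t - h))
      (C := ε) (φ := InnerProductSpace.toDual ℝ E (gradient (U t) X)) (x := Y) (y := X)
      (fun z _ => hX _ hts z) (fun z hz => ?_) ?_ (Metric.mem_ball_self hδ₂)
    · simpa [real_inner_comm] using this
    · rw [← (InnerProductSpace.toDual ℝ E).symm.norm_map, map_sub,
        LinearIsometryEquiv.symm_apply_apply, ← dist_eq_norm]
      refine (h2 (x := (t - h, z)) ⟨hts, mem_univ _⟩ ?_).le
      rw [Prod.dist_eq, max_lt_iff]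
      exact ⟨by simpa [Real.dist_eq, abs_of_pos hh0] using hh.2.2, hz⟩
    · rw [Metric.mem_ball, dist_comm, dist_eq_norm]; exact hY.2.2
  rw [abs_le] at h3 h4 ⊢
  constructor <;> linarith [h3.1, h3.2, h4.1, h4.2]

/-! ### The two inequalities -/

namespace StandingAssumptions
variable {d : ℕ} {L H : State d → State d → ℝ} {Φ Ψ : State d → ℝ}
  {c₀ c₁ lam₀ cΦ cΨ T : ℝ}

/-- Comparison with the segment of velocity `V` that ends in `X`; `a` and `P` are the coefficients
of a first-order expansion of the value function at `(t, X)`, backward in time. -/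
theorem add_inner_le_LHat (hA : StandingAssumptions L H Φ Ψ c₀ c₁ lam₀ cΦ cΨ T)
    {t a : ℝ} {X P : HSpace d}
    (hexp : ∀ ε : ℝ, 0 < ε → ∃ δ : ℝ, 0 < δ ∧ δ ≤ t ∧ ∀ h ∈ Ioo 0 δ, ∀ Y, ‖X - Y‖ < δ →
      |valueFn L Φ Ψ t X - valueFn L Φ Ψ (t - h) Y - (h * a + ⟪X - Y, P⟫)| ≤
        ε * (h + ‖X - Y‖)) (V : HSpace d) :
    a + ⟪V, P⟫ ≤ LHat L Φ X V := by
  obtain ⟨K, hK, hL⟩ := hA.exists_LHat_lipschitz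
  have hN : 0 < 1 + ‖V‖ := by positivity
  refine le_of_forall_pos_le_add fun η hη => ?_
  obtain ⟨δ, hδ, hδt, hexp⟩ := hexp (η / 2 / (1 + ‖V‖)) (by positivity)
  -- A time step so short that the segment stays close to `X`.
  obtain ⟨h, hh, hhδ⟩ := exists_pos_mul_lt (lt_min hδ (by positivity : (0 : ℝ) < η / 2))
    ((1 + K) * (1 + ‖V‖))
  rw [lt_min_iff] at hhδ
  have hV := norm_nonneg V
  have hKV : 0 ≤ K * ‖V‖ := mul_nonneg hK hV
  have e1 : (1 + K) * (1 + ‖V‖) * h = h + h * ‖V‖ + h * K + h * (K * ‖V‖) := by ring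
  have hhV : 0 ≤ h * ‖V‖ := by positivity
  have hhK : 0 ≤ h * K := by positivity
  have hhKV : 0 ≤ h * (K * ‖V‖) := by positivity
  have hn : ‖X - (X - h • V)‖ = h * ‖V‖ := by
    rw [sub_sub_cancel, norm_smul, Real.norm_of_nonneg hh.le]
  have h1 := hexp h ⟨hh, by linarith⟩ (X - h • V) (by rw [hn]; linarith)
  rw [hn, sub_sub_cancel, real_inner_smul_left, abs_le] at h1
  have h2 := hA.valueFn_le_of_segment (s := t - h) (t := t) (by linarith) (by linarith)
    (X - h • V) V
  rw [sub_sub_cancel, sub_add_cancel] at h2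
  have hc : Continuous fun r : ℝ => LHat L Φ (X - h • V + (r - (t - h)) • V) V :=
    (hA.continuous_LHat_left V).comp (by fun_prop)
  have h3 : ∫ r in (t - h)..t, LHat L Φ (X - h • V + (r - (t - h)) • V) V ≤
      ∫ r in (t - h)..t, (LHat L Φ X V + K * (h * ‖V‖)) := by
    refine intervalIntegral.integral_mono_on (by linarith) (hc.intervalIntegrable _ _)
      intervalIntegrable_const fun r hr => ?_
    have h4 := (abs_le.1 (hL (X - h • V + (r - (t - h)) • V) X V)).2
    have h5 : X - h • V + (r - (t - h)) • V - X = (r - t) • V := by module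
    have h6 : ‖(r - t) • V‖ ≤ h * ‖V‖ := by
      rw [norm_smul, Real.norm_eq_abs]
      gcongr
      exact abs_le.2 ⟨by linarith [hr.1], by linarith [hr.2]⟩
    rw [h5] at h4
    linarith [mul_le_mul_of_nonneg_left h6 hK]
  rw [intervalIntegral.integral_const, sub_sub_cancel, smul_eq_mul] at h3
  have h7 : η / 2 / (1 + ‖V‖) * (h + h * ‖V‖) = h * (η / 2) := by field_simp
  have h8 : h * (a + ⟪V, P⟫) ≤ h * (LHat L Φ X V + K * (h * ‖V‖) + η / 2) := by
    linarith [h1.1]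
  have h9 := le_of_mul_le_mul_left h8 hh
  linarith

/-- Comparison with near-optimal curves. Coercivity of `L̂` bounds the displacement of such a curve
during the last `h` units of time by a multiple of `h`, so the first-order expansion applies. -/
theorem neg_HHat_le (hA : StandingAssumptions L H Φ Ψ c₀ c₁ lam₀ cΦ cΨ T)
    {t a : ℝ} {X P : HSpace d}
    (hexp : ∀ ε : ℝ, 0 < ε → ∃ δ : ℝ, 0 < δ ∧ δ ≤ t ∧ ∀ h ∈ Ioo 0 δ, ∀ Y, ‖X - Y‖ < δ →
      |valueFn L Φ Ψ t X - valueFn L Φ Ψ (t - h) Y - (h * a + ⟪X - Y, P⟫)| ≤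
        ε * (h + ‖X - Y‖)) :
    -HHat H Φ X P ≤ a := by
  obtain ⟨K, hK, hL⟩ := hA.exists_LHat_lipschitz
  obtain ⟨m, hm⟩ := hA.exists_LHat_coercive
  obtain ⟨m₁, m₂, hU⟩ := hA.exists_valueFn_ge
  have hc := hA.c₀_pos
  -- `S` bounds the kinetic energy of the curves below; `Q * h` will bound their displacement.
  set S : ℝ := (|valueFn L Φ Ψ t X| + 1 + t * |m₁| + |m₂| + |m|) / c₀ with hS
  have hP := norm_nonneg P
  set Q : ℝ := (|a| + 2 + |m| + ‖P‖ + 1) / c₀ + 1 with hQ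
  have hQ0 : 0 ≤ (|a| + 2 + |m| + ‖P‖ + 1) / c₀ := by positivity
  refine le_of_forall_pos_le_add fun η hη => ?_
  obtain ⟨ε, hε, hε1, hεη⟩ : ∃ ε : ℝ, 0 < ε ∧ ε ≤ 1 ∧ ε * (1 + Q) ≤ η / 3 := by
    have hQ1 : 0 < 1 + Q := by linarith
    refine ⟨min 1 (η / 3 / (1 + Q)), lt_min one_pos (by positivity), min_le_left _ _, ?_⟩
    rw [← le_div_iff₀ hQ1]
    exact min_le_right _ _
  obtain ⟨δ, hδ, hδt, hexp⟩ := hexp ε hε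
  have ht : 0 < t := hδ.trans_le hδt
  have hS0 : 0 ≤ S := by positivity
  -- The radius `ρ` in which the curve is to remain, and a time step that ensures this.
  obtain ⟨ρ, hρ, hρδ, hρη⟩ : ∃ ρ : ℝ, 0 < ρ ∧ ρ < δ ∧ K * ρ < η / 3 := by
    obtain ⟨ρ, hρ, h1⟩ := exists_pos_mul_lt (lt_min hδ (by positivity : (0 : ℝ) < η / 3)) (1 + K)
    rw [lt_min_iff] at h1
    have : 0 ≤ K * ρ := by positivity
    exact ⟨ρ, hρ, by linarith, by linarith⟩
  obtain ⟨h, hh, hh1, hhδ, hhη, hhS⟩ :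
      ∃ h : ℝ, 0 < h ∧ h ≤ 1 ∧ h < δ ∧ h ≤ η / 3 ∧ h * S ≤ ρ ^ 2 := by
    obtain ⟨h, hh, h1⟩ := exists_pos_mul_lt
      (lt_min (lt_min one_pos hδ) (lt_min (by positivity : (0 : ℝ) < η / 3)
        (by positivity : (0 : ℝ) < ρ ^ 2))) (1 + S)
    simp only [lt_min_iff] at h1
    have : 0 ≤ S * h := by positivity
    exact ⟨h, hh, by linarith, by linarith, by linarith, by linarith⟩
  obtain ⟨γ, V, hγ, hX, hi, hopt⟩ := hA.exists_valueFn_add_integral_le (Ψ := Ψ) t X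
    (by positivity : (0 : ℝ) < h ^ 2)
  have hs : t - h ∈ Icc 0 t := ⟨by linarith, by linarith⟩
  have htt : t ∈ Icc 0 t := ⟨ht.le, le_rfl⟩
  have hle : t - h ≤ t := hs.2
  have hi2 : IntervalIntegrable (fun r => LHat L Φ (γ r) (V r)) volume (t - h) t :=
    hi.mono_set (by rw [uIcc_of_le hs.2, uIcc_of_le ht.le]; exact Icc_subset_Icc_left hs.1)
  have hopt := hopt (t - h) hs
  have hV2 := hγ.intervalIntegrable_norm_sq hs htt
  set A := ∫ r in (t - h)..t, LHat L Φ (γ r) (V r) with hAdef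
  set E := ∫ r in (t - h)..t, ‖V r‖ ^ 2 with hE
  have hsq : h ^ 2 ≤ h := by nlinarith
  -- Kinetic energy is controlled by the action.
  have hEA : c₀ * E + h * m ≤ A := by
    have h1 : ∫ r in (t - h)..t, (c₀ * ‖V r‖ ^ 2 + m) ≤ A :=
      intervalIntegral.integral_mono hle ((hV2.const_mul c₀).add intervalIntegrable_const) hi2
        fun r => hm (γ r) (V r)
    rwa [intervalIntegral.integral_add (hV2.const_mul c₀) intervalIntegrable_const,
      intervalIntegral.integral_const_mul, intervalIntegral.integral_const, sub_sub_cancel,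
      smul_eq_mul] at h1
  have hhm : -(h * |m|) ≤ h * m := by nlinarith [neg_abs_le m]
  have hhm1 : h * |m| ≤ |m| := mul_le_of_le_one_left (abs_nonneg m) hh1
  -- A crude energy bound, from the lower bound of the value function at time `t - h`.
  have hES : E ≤ S := by
    rw [hS, le_div_iff₀ hc]
    have h1 := hU (t - h) hs.1 (γ (t - h))
    have h2 : -(t * |m₁|) ≤ (t - h) * m₁ := by
      nlinarith [neg_abs_le m₁, abs_nonneg m₁, hs.1]
    linarith [le_abs_self (valueFn L Φ Ψ t X), neg_abs_le m₂]
  have hnear : ∀ r ∈ Icc (t - h) t, ‖γ r - X‖ ≤ ρ := by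
    intro r hr
    have hr0 : r ∈ Icc 0 t := ⟨hs.1.trans hr.1, hr.2⟩
    have h1 := hγ.norm_sub_sq_le hr0 htt hr.2
    have h2 : ∫ x in r..t, ‖V x‖ ^ 2 ≤ E :=
      intervalIntegral.integral_mono_interval hr.1 hr.2 le_rfl
        (Filter.Eventually.of_forall fun _ => sq_nonneg _) hV2
    have h3 : 0 ≤ ∫ x in r..t, ‖V x‖ ^ 2 :=
      intervalIntegral.integral_nonneg hr.2 fun _ _ => sq_nonneg _
    rw [hX, norm_sub_rev] at h1
    have h4 : (t - r) * ∫ x in r..t, ‖V x‖ ^ 2 ≤ h * S :=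
      mul_le_mul (by linarith [hr.1]) (h2.trans hES) h3 hh.le
    exact (sq_le_sq₀ (norm_nonneg _) hρ.le).1 (by linarith)
  set D := X - γ (t - h) with hD
  have hDρ : ‖D‖ ≤ ρ := by
    rw [hD, norm_sub_rev]; exact hnear _ ⟨le_rfl, hle⟩
  have hexp := (abs_le.1 (hexp h ⟨hh, hhδ⟩ (γ (t - h)) (hDρ.trans_lt hρδ))).2
  rw [← hD] at hexp
  have hDn := norm_nonneg D
  -- The displacement is of order `h`.
  have hDQ : ‖D‖ ≤ Q * h := by
    have h1 : ‖D‖ ^ 2 ≤ h * E := by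
      have := hγ.norm_sub_sq_le hs htt hle
      rwa [hX, sub_sub_cancel] at this
    have h2 := real_inner_le_norm D P
    have h3 : ε * (h + ‖D‖) ≤ h + ‖D‖ := mul_le_of_le_one_left (by positivity) hε1
    have h4 : h * a ≤ h * |a| := by gcongr; exact le_abs_self a
    have h5 : c₀ * E ≤ h * (|a| + 2 + |m|) + (‖P‖ + 1) * ‖D‖ := by
      linarith
    by_contra! hcon
    have hhD : h ≤ ‖D‖ := by nlinarith
    have h6 : h * (|a| + 2 + |m|) ≤ ‖D‖ * (|a| + 2 + |m|) := by gcongr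
    have h7 : c₀ * E ≤ (|a| + 2 + |m| + ‖P‖ + 1) * ‖D‖ := by linarith
    have h8 : c₀ * ‖D‖ ^ 2 ≤ h * ((|a| + 2 + |m| + ‖P‖ + 1) * ‖D‖) := by
      calc c₀ * ‖D‖ ^ 2 ≤ c₀ * (h * E) := by gcongr
        _ = h * (c₀ * E) := by ring
        _ ≤ _ := by gcongr
    have hDpos : 0 < ‖D‖ := hh.trans_le hhD
    have h9 : c₀ * ‖D‖ ≤ h * (|a| + 2 + |m| + ‖P‖ + 1) := by
      refine le_of_mul_le_mul_right ?_ hDpos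
      linarith
    have h10 : ‖D‖ ≤ (|a| + 2 + |m| + ‖P‖ + 1) / c₀ * h := by
      rw [div_mul_eq_mul_div, le_div_iff₀ hc]
      linarith
    rw [hQ] at hcon
    linarith
  -- Fenchel–Young along the curve, with the fixed covector `P`.
  have hAlow : ⟪D, P⟫ - h * (HHat H Φ X P + K * ρ) ≤ A := by
    have hVi := hγ.intervalIntegrable hs htt
    have hin : IntervalIntegrable (fun r => ⟪P, V r⟫) volume (t - h) t :=
      ⟨(innerSL ℝ P).integrable_comp hVi.1, (innerSL ℝ P).integrable_comp hVi.2⟩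
    have h1 : ∫ r in (t - h)..t, (⟪P, V r⟫ - (HHat H Φ X P + K * ρ)) ≤ A := by
      refine intervalIntegral.integral_mono_on hle (hin.sub intervalIntegrable_const) hi2
        fun r hr => ?_
      have h2 := hA.inner_le_LHat_add_HHat X P (V r)
      have h3 := (abs_le.1 (hL (γ r) X (V r))).1
      have h4 := mul_le_mul_of_nonneg_left (hnear r hr) hK
      rw [real_inner_comm] at h2
      linarith
    have h2 : ∫ r in (t - h)..t, ⟪P, V r⟫ = ⟪P, D⟫ := by
      rw [hD, ← hX, hγ.sub_eq_integral hs htt]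
      exact (innerSL ℝ P).intervalIntegral_comp_comm hVi
    rwa [intervalIntegral.integral_sub hin intervalIntegrable_const, h2,
      intervalIntegral.integral_const, sub_sub_cancel, smul_eq_mul, real_inner_comm] at h1
  have h1 : ε * (h + ‖D‖) ≤ h * (η / 3) := by
    calc ε * (h + ‖D‖) ≤ ε * (h + Q * h) := by gcongr
      _ = h * (ε * (1 + Q)) := by ring
      _ ≤ _ := by gcongr
  have h2 : h ^ 2 ≤ h * (η / 3) := by rw [sq]; gcongr
  have h3 : h * (K * ρ) ≤ h * (η / 3) := by gcongr
  have h4 : h * (-HHat H Φ X P) ≤ h * (a + η) := by linarith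
  exact le_of_mul_le_mul_left h4 hh

end StandingAssumptions

end MeanFieldHJ

theorem mainTheorem3 {d : ℕ}
    (L H : MeanFieldHJ.State d → MeanFieldHJ.State d → ℝ) (Φ Ψ : MeanFieldHJ.State d → ℝ)
    (c₀ c₁ lam₀ cΦ cΨ T : ℝ)
    (hA : MeanFieldHJ.StandingAssumptions L H Φ Ψ c₀ c₁ lam₀ cΦ cΨ T)
    -- the partial derivative in time exists and is continuous (one-sided at the final time)
    (ht : ∀ t ∈ Set.Ioc 0 T, ∀ X : MeanFieldHJ.HSpace d,
      DifferentiableWithinAt ℝ (fun s => MeanFieldHJ.valueFn L Φ Ψ s X) (Set.Icc 0 T) t)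
    (htc : ContinuousOn
      (fun z : ℝ × MeanFieldHJ.HSpace d =>
        derivWithin (fun s => MeanFieldHJ.valueFn L Φ Ψ s z.2) (Set.Icc 0 T) z.1)
      (Set.Ioc 0 T ×ˢ Set.univ))
    -- the gradient in the Hilbert space exists and is continuous
    (hX : ∀ t ∈ Set.Ioc 0 T, ∀ X : MeanFieldHJ.HSpace d,
      DifferentiableAt ℝ (MeanFieldHJ.valueFn L Φ Ψ t) X)
    (hXc : ContinuousOn
      (fun z : ℝ × MeanFieldHJ.HSpace d => gradient (MeanFieldHJ.valueFn L Φ Ψ z.1) z.2)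
      (Set.Ioc 0 T ×ˢ Set.univ)) :
    ∀ t ∈ Set.Ioc 0 T, ∀ X : MeanFieldHJ.HSpace d,
      MeasureTheory.Integrable
        (fun ω => H (X ω) ((gradient (MeanFieldHJ.valueFn L Φ Ψ t) X) ω))
        MeanFieldHJ.playerMeasure ∧
      derivWithin (fun s => MeanFieldHJ.valueFn L Φ Ψ s X) (Set.Icc 0 T) t +
        MeanFieldHJ.HHat H Φ X (gradient (MeanFieldHJ.valueFn L Φ Ψ t) X) = 0 := by
  intro t htT X
  obtain ⟨V, hV⟩ := hA.exists_inner_eq_LHat_add_HHat X (gradient (MeanFieldHJ.valueFn L Φ Ψ t) X)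
  have hexp := fun ε (hε : (0 : ℝ) < ε) =>
    MeanFieldHJ.exists_backward_expansion (U := MeanFieldHJ.valueFn L Φ Ψ) htT X (ht t htT X)
      (fun s hs => hX s hs) hXc hε
  have h1 := hA.add_inner_le_LHat hexp V
  have h2 := hA.neg_HHat_le hexp
  exact ⟨hA.integrable_hamiltonian X _, by linarith⟩
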